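/- Let $\mathcal A$ be an Archimedean uniformly complete $f$-algebra: a real vector lattice with an associative bilinear multiplication (not assumed commutative or unital) such that $ab\ge 0$ for $a,b\ge 0$, and $a\wedge b=0$, $c\ge 0$ imply $(ac)\wedge b=(ca)\wedge b=0$; Archimedean means that $0\le nx\le y$ for all $n\in\mathbb N$ implies $x=0$, and uniformly complete means that for each $e\ge 0$ every $e$-uniform Cauchy sequence has an $e$-uniform limit. Let $p\ge 2$ be an integer. In a vector lattice $V$, an element $z\ge 0$ is called a majorant of $\varphi\in V$ if for every $x\in V$ there is a real $c>0$ with $|x|\wedge n|\varphi|\le c\,z$ for all $n\in\mathbb N$; and $\varphi$ is called finite in $V$ if it has a majorant in $V$. The set $\Pi_p(\mathcal A)=\{g_1\cdots g_p : g_1,\dots,g_p\in\mathcal A\}$ is a subalgebra and a sublattice of $\mathcal A$, hence a vector lattice under the inherited operations and order, and the following holds. (1) For all $g,u\in\mathcal A$: if $u$ is a majorant of $g$ in $\mathcal A$, then $u^p$ is a majorant of $g^p$ in $\Pi_p(\mathcal A)$; in particular $g^p$ is finite in $\Pi_p(\mathcal A)$ whenever $g$ is finite in $\mathcal A$. (2)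 Suppose in addition that $\mathcal A$ is semiprime, i.e. $0$ is its only nilpotent element. Then for all $g\in\mathcal A$ and all $u\in\mathcal A$ with $u\ge 0$, the element $u$ is a majorant of $g$ in $\mathcal A$ if and only if $u^p$ is a majorant of $g^p$ in $\Pi_p(\mathcal A)$. Moreover, $g$ is finite in $\mathcal A$ if and only if $g^p$ is finite in $\Pi_p(\mathcal A)$. -/

import Mathlib

section VectorLattices

variable (V : Type*) [AddCommGroup V] [Lattice V] [Module ℝ V]

/-- A vector lattice is Archimedean if `0 ≤ x`, `0 ≤ y` and `n x ≤ y` for all `n` force `x = 0`.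
(The class `Archimedean` of Mathlib is a different notion outside linear orders.) -/
def IsArchimedeanLattice : Prop :=
  ∀ x y : V, 0 ≤ x → 0 ≤ y → (∀ n : ℕ, n • x ≤ y) → x = 0

/-- A vector lattice is uniformly complete if for every `e ≥ 0` each `e`-uniform Cauchy sequence
has an `e`-uniform limit. -/
def IsUniformlyComplete : Prop :=
  ∀ e : V, 0 ≤ e → ∀ s : ℕ → V,
    (∀ ε : ℝ, 0 < ε → ∃ N : ℕ, ∀ m n : ℕ, N ≤ m → N ≤ n → |s m - s n| ≤ ε • e) →
    ∃ x : V, ∀ ε : ℝ, 0 < ε → ∃ N : ℕ, ∀ n : ℕ, N ≤ n → |s n - x| ≤ ε • e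

variable {V}

/-- `z` is a majorant of `φ` in the vector lattice `V`. -/
def IsMajorant (φ z : V) : Prop :=
  0 ≤ z ∧ ∀ x : V, ∃ c : ℝ, 0 < c ∧ ∀ n : ℕ, |x| ⊓ (n • |φ|) ≤ c • z

/-- `φ` is a finite element of the vector lattice `V`. -/
def IsFiniteElement (φ : V) : Prop :=
  ∃ z : V, IsMajorant φ z

end VectorLattices

section Algebras

/-- The conditions that make a vector lattice with an associative, bilinear multiplication
(not assumed commutative or unital) an `f`-algebra. -/
class IsFAlgebra (A : Type*) [NonUnitalRing A] [Lattice A] : Prop where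
  mul_nonneg' : ∀ a b : A, 0 ≤ a → 0 ≤ b → 0 ≤ a * b
  mul_right_inf : ∀ a b c : A, a ⊓ b = 0 → 0 ≤ c → (a * c) ⊓ b = 0
  mul_left_inf : ∀ a b c : A, a ⊓ b = 0 → 0 ≤ c → (c * a) ⊓ b = 0

variable {A : Type*} [NonUnitalRing A]

/-- The product `g₁ ⋯ gₚ` of `p ≥ 1` elements; the value at `p = 0` has no meaning, as there need
not be a unit. -/
def finProd : (p : ℕ) → (Fin p → A) → A
  | 0, _ => 0
  | 1, g => g 0
  | n + 2, g => finProd (n + 1) (fun i => g i.castSucc) * g (Fin.last (n + 1))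

/-- The power `aᵖ` for `p ≥ 1`. -/
def finPow (p : ℕ) (a : A) : A := finProd p (fun _ => a)

variable (A) in
/-- `A` has no nilpotent element other than zero. -/
def IsSemiprimeAlgebra : Prop :=
  ∀ a : A, (∃ n : ℕ, 1 ≤ n ∧ finPow n a = 0) → a = 0

variable (A) in
/-- The set `Π_p(A)` of all `p`-fold products. -/
def productSet (p : ℕ) : Set A := {x | ∃ g : Fin p → A, x = finProd p g}

theorem finPow_mem_productSet (p : ℕ) (a : A) : finPow p a ∈ productSet A p :=
  ⟨fun _ => a, rfl⟩

end Algebras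

/-- A subalgebra (linear subspace closed under multiplication) that is also a sublattice. -/
structure LatticeSubalgebra (A : Type*) [NonUnitalRing A] [Lattice A] [Module ℝ A] extends
    NonUnitalSubalgebra ℝ A where
  sup_mem' : ∀ {a b : A}, a ∈ carrier → b ∈ carrier → a ⊔ b ∈ carrier
  inf_mem' : ∀ {a b : A}, a ∈ carrier → b ∈ carrier → a ⊓ b ∈ carrier

namespace LatticeSubalgebra

variable {A : Type*} [NonUnitalRing A] [Lattice A] [Module ℝ A]

instance : SetLike (LatticeSubalgebra A) A where
  coe P := P.carrier
  coe_injective P Q h := by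
    cases P
    cases Q
    congr
    exact SetLike.coe_injective h

/-- The ring operations are those of `A`. -/
instance (P : LatticeSubalgebra A) : NonUnitalRing P :=
  inferInstanceAs (NonUnitalRing P.toNonUnitalSubalgebra)

/-- The scalar multiplication is that of `A`. -/
instance (P : LatticeSubalgebra A) : Module ℝ P :=
  inferInstanceAs (Module ℝ P.toNonUnitalSubalgebra)

/-- The order is the one inherited from `A`. -/
instance (P : LatticeSubalgebra A) : Lattice P :=
  Subtype.lattice (fun _ _ ha hb => P.sup_mem' ha hb) (fun _ _ ha hb => P.inf_mem' ha hb)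

/-- The power `aᵖ` as an element of a lattice subalgebra whose underlying set is `Π_p(A)`. -/
def pow {P : LatticeSubalgebra A} {p : ℕ} (h : (P : Set A) = productSet A p) (a : A) : P :=
  ⟨finPow p a, h.symm.subset (finPow_mem_productSet p a)⟩

end LatticeSubalgebra

/-!
In an Archimedean vector lattice, the order of the ideal generated by `e ≥ 0` is detected by its
lattice characters `τ` with `τ e = 1`, which come from prime order ideals (Yosida). In an
`f`-algebra, every character `ω` of the ideal generated by `eᵖ` is a `p`-th power, in the sense that
`ω (f₁ ⋯ fₚ) = τ f₁ ⋯ τ fₚ` for some character `τ` of the ideal generated by `e`: two functionals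
that cannot both be nonzero on disjoint elements are proportional.

By Stone–Weierstrass and uniform completeness, continuous functions operate on elements of `A`. In
particular a sum of two `p`-fold products has a `p`-th root, so that `Π_p(A)` is the set of
the elements `|φ|ᵖ⁻¹ φ`, and this makes it a lattice subalgebra.

For `f, g, u ≥ 0`, the inequalities `f ⊓ n g ≤ u` for all `n` say that `τ f ≤ τ u` whenever
`τ g > 0`, a condition which is stable under `p`-th powers. In the semiprime case the characters `τ`
that occur in `p`-th powers are enough to detect the order of `A`, and the condition on `p`-th
powers implies the condition itself.
-/

section LatticeOrderedGroups

variable {A : Type*} [AddCommGroup A] [Lattice A] [IsOrderedAddMonoid A] {a b c : A}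

theorem add_inf_eq_zero (hac : a ⊓ c = 0) (hbc : b ⊓ c = 0) : (a + b) ⊓ c = 0 := by
  have ha : 0 ≤ a := hac ▸ inf_le_left
  have hb : 0 ≤ b := hbc ▸ inf_le_left
  have hc : 0 ≤ c := hac ▸ inf_le_right
  refine le_antisymm ?_ (le_inf (add_nonneg ha hb) hc)
  have hle : (a + b) ⊓ c - b ≤ 0 := by
    rw [← hac]
    exact le_inf (sub_le_iff_le_add.2 inf_le_left)
      ((sub_le_self _ hb).trans inf_le_right)
  rw [← hbc]
  exact le_inf (sub_nonpos.1 hle) inf_le_right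

theorem abs_sub_eq_add_of_inf_eq_zero (hab : a ⊓ b = 0) : |a - b| = a + b := by
  rw [abs_sub_comm, ← sup_sub_inf_eq_abs_sub, ← inf_add_sup a b, hab, sub_zero, zero_add]

theorem posPart_sub_eq_of_inf_eq_zero (hab : a ⊓ b = 0) : (a - b)⁺ = a := by
  rw [← sub_sub_self a (a - b)⁺, ← inf_eq_sub_posPart_sub, hab, sub_zero]

end LatticeOrderedGroups

section OrderedModules

variable {A : Type*} [AddCommGroup A] [Lattice A] [Module ℝ A] [IsOrderedModule ℝ A]

theorem smul_inf_of_pos {r : ℝ} (hr : 0 < r) (a b : A) : r • (a ⊓ b) = r • a ⊓ r • b :=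
  (OrderIso.smulRight hr).map_inf a b

theorem smul_abs_of_pos {r : ℝ} (hr : 0 < r) (a : A) : r • |a| = |r • a| := by
  rw [abs, abs, ← smul_neg]
  exact (OrderIso.smulRight hr).map_sup a (-a)

theorem abs_smul_eq_smul_abs [IsOrderedAddMonoid A] (r : ℝ) (a : A) : |r • a| = |r| • |a| := by
  rcases lt_trichotomy r 0 with hr | rfl | hr
  · rw [abs_of_neg hr, smul_abs_of_pos (neg_pos.2 hr), neg_smul, abs_neg]
  · rw [zero_smul, abs_zero, abs_zero, zero_smul]
  · rw [abs_of_pos hr, smul_abs_of_pos hr]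

end OrderedModules

section OrderIdeals

variable {A : Type*} [AddCommGroup A] [Lattice A] [Module ℝ A]

/-- Order ideals of a vector lattice: the subspaces that contain with `x` every `y` such that
`|y| ≤ |x|`. -/
def IsOrderIdeal (P : Submodule ℝ A) : Prop :=
  LatticeOrderedAddCommGroup.IsSolid (P : Set A)

/-- Prime order ideals, which contain one of any two disjoint elements. They are the source of
lattice characters. -/
structure IsPrimeOrderIdeal (P : Submodule ℝ A) : Prop where
  isOrderIdeal : IsOrderIdeal P
  mem_or_mem : ∀ a b : A, a ⊓ b = 0 → a ∈ P ∨ b ∈ P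

variable [IsOrderedAddMonoid A] {P : Submodule ℝ A} {a b : A}

namespace IsOrderIdeal

theorem mem_of_nonneg_of_le (hP : IsOrderIdeal P) (hb : b ∈ P) (ha : 0 ≤ a) (hab : a ≤ b) :
    a ∈ P :=
  hP hb (abs_le_abs_of_nonneg ha hab)

theorem abs_mem (hP : IsOrderIdeal P) (ha : a ∈ P) : |a| ∈ P :=
  hP ha (abs_abs a).le

theorem posPart_mem (hP : IsOrderIdeal P) (ha : a ∈ P) : a⁺ ∈ P :=
  hP.mem_of_nonneg_of_le (hP.abs_mem ha) (posPart_nonneg a)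
    (sup_le (le_abs_self a) (abs_nonneg a))

theorem negPart_mem (hP : IsOrderIdeal P) (ha : a ∈ P) : a⁻ ∈ P :=
  posPart_neg a ▸ hP.posPart_mem (neg_mem ha)

theorem inf_mem (hP : IsOrderIdeal P) (ha : a ∈ P) (hb : b ∈ P) : a ⊓ b ∈ P :=
  inf_eq_sub_posPart_sub a b ▸ sub_mem ha (hP.posPart_mem (sub_mem ha hb))

theorem sup_mem (hP : IsOrderIdeal P) (ha : a ∈ P) (hb : b ∈ P) : a ⊔ b ∈ P :=
  sup_eq_add_posPart_sub a b ▸ add_mem hb (hP.posPart_mem (sub_mem ha hb))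

end IsOrderIdeal

theorem exists_maximal_isOrderIdeal_notMem {y : A} (hy : y ≠ 0) :
    ∃ P : Submodule ℝ A, Maximal (fun P => IsOrderIdeal P ∧ y ∉ P) P := by
  have hbot : IsOrderIdeal (⊥ : Submodule ℝ A) := by
    rintro x rfl z hz
    rw [abs_zero] at hz
    exact le_antisymm ((le_abs_self z).trans hz) (neg_nonpos.1 ((neg_le_abs z).trans hz))
  refine (zorn_le_nonempty₀ {P : Submodule ℝ A | IsOrderIdeal P ∧ y ∉ P} ?_ ⊥
    ⟨hbot, hy⟩).imp fun P hP => hP.2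
  intro c hc hchain Q hQ
  have hmem {x : A} : x ∈ sSup c ↔ ∃ R ∈ c, x ∈ R :=
    Submodule.mem_sSup_of_directed ⟨Q, hQ⟩ hchain.directedOn
  refine ⟨sSup c, ⟨fun x hx z hz => ?_, fun hyc => ?_⟩, fun R hR => le_sSup hR⟩
  · obtain ⟨R, hR, hxR⟩ := hmem.1 hx
    exact hmem.2 ⟨R, hR, (hc hR).1 hxR hz⟩
  · obtain ⟨R, hR, hyR⟩ := hmem.1 hyc
    exact (hc hR).2 hyR

variable [IsOrderedModule ℝ A]

/-- The order ideal generated by the subspace `P`, for `P` generated by positive elements. -/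
def orderIdealSpan (P : Submodule ℝ A) : Submodule ℝ A where
  carrier := {x | ∃ q ∈ P, |x| ≤ q}
  zero_mem' := ⟨0, zero_mem P, by simp only [abs_zero, le_refl]⟩
  add_mem' := by
    rintro x y ⟨q, hq, hxq⟩ ⟨r, hr, hyr⟩
    exact ⟨q + r, add_mem hq hr, (abs_add_le x y).trans (add_le_add hxq hyr)⟩
  smul_mem' := by
    rintro r x ⟨q, hq, hxq⟩
    exact ⟨|r| • q, P.smul_mem _ hq,
      (abs_smul_eq_smul_abs r x).trans_le (smul_le_smul_of_nonneg_left hxq (abs_nonneg r))⟩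

theorem isOrderIdeal_orderIdealSpan (P : Submodule ℝ A) : IsOrderIdeal (orderIdealSpan P) := by
  rintro x ⟨q, hq, hxq⟩ y hyx
  exact ⟨q, hq, hyx.trans hxq⟩

theorem mem_orderIdealSpan_of_nonneg (ha : 0 ≤ a) (haP : a ∈ P) : a ∈ orderIdealSpan P :=
  ⟨a, haP, (abs_of_nonneg ha).le⟩

/-- The order ideal generated by a positive element `e`. -/
def principalIdeal (e : A) : Submodule ℝ A :=
  orderIdealSpan (ℝ ∙ e)

theorem mem_principalIdeal {e : A} : a ∈ principalIdeal e ↔ ∃ c : ℝ, |a| ≤ c • e := by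
  constructor
  · rintro ⟨_, hq, haq⟩
    obtain ⟨c, rfl⟩ := Submodule.mem_span_singleton.1 hq
    exact ⟨c, haq⟩
  · rintro ⟨c, hac⟩
    exact ⟨c • e, Submodule.smul_mem _ c (Submodule.mem_span_singleton_self e), hac⟩

theorem isOrderIdeal_principalIdeal (e : A) : IsOrderIdeal (principalIdeal e) :=
  isOrderIdeal_orderIdealSpan _

theorem mem_principalIdeal_of_abs_le {e : A} (h : |a| ≤ e) : a ∈ principalIdeal e :=
  mem_principalIdeal.2 ⟨1, by rwa [one_smul]⟩

theorem self_mem_principalIdeal {e : A} (he : 0 ≤ e) : e ∈ principalIdeal e :=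
  mem_principalIdeal_of_abs_le (abs_of_nonneg he).le

theorem exists_abs_le_add_smul_of_mem_orderIdealSpan_sup {x : A} (ha : 0 ≤ a)
    (hx : x ∈ orderIdealSpan (P ⊔ ℝ ∙ a)) : ∃ q ∈ P, ∃ c : ℝ, 0 < c ∧ |x| ≤ q + c • a := by
  obtain ⟨_, hr, hxr⟩ := hx
  obtain ⟨q, hq, _, hs, rfl⟩ := Submodule.mem_sup.1 hr
  obtain ⟨c, rfl⟩ := Submodule.mem_span_singleton.1 hs
  refine ⟨q, hq, |c| + 1, by positivity, hxr.trans (add_le_add_right ?_ q)⟩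
  exact smul_le_smul_of_nonneg_right (by linarith [le_abs_self c]) ha

theorem IsOrderIdeal.mem_of_mem_orderIdealSpan_sup (hP : IsOrderIdeal P) (hab : a ⊓ b = 0) {y : A}
    (hya : y ∈ orderIdealSpan (P ⊔ ℝ ∙ a)) (hyb : y ∈ orderIdealSpan (P ⊔ ℝ ∙ b)) : y ∈ P := by
  have ha : 0 ≤ a := hab ▸ inf_le_left
  have hb : 0 ≤ b := hab ▸ inf_le_right
  obtain ⟨q, hq, c, hc, hyq⟩ := exists_abs_le_add_smul_of_mem_orderIdealSpan_sup ha hya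
  obtain ⟨r, hr, d, hd, hyr⟩ := exists_abs_le_add_smul_of_mem_orderIdealSpan_sup hb hyb
  have hle : |y| - (|q| + |r|) ≤ (c + d) • a ⊓ (c + d) • b := by
    refine le_inf ?_ ?_ <;> rw [sub_le_iff_le_add']
    · exact hyq.trans (add_le_add ((le_abs_self q).trans (le_add_of_nonneg_right (abs_nonneg r)))
        (smul_le_smul_of_nonneg_right (by linarith) ha))
    · exact hyr.trans (add_le_add ((le_abs_self r).trans (le_add_of_nonneg_left (abs_nonneg q)))
        (smul_le_smul_of_nonneg_right (by linarith) hb))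
  rw [← smul_inf_of_pos (add_pos hc hd), hab, smul_zero, sub_nonpos] at hle
  exact hP (add_mem (hP.abs_mem hq) (hP.abs_mem hr)) (hle.trans (le_abs_self _))

theorem exists_isPrimeOrderIdeal_notMem {y : A} (hy : y ≠ 0) :
    ∃ P : Submodule ℝ A, IsPrimeOrderIdeal P ∧ y ∉ P := by
  obtain ⟨P, ⟨hP, hyP⟩, hmax⟩ := exists_maximal_isOrderIdeal_notMem hy
  refine ⟨P, ⟨hP, fun a b hab => ?_⟩, hyP⟩
  have mem_span {d : A} (hd : 0 ≤ d) (hdP : d ∉ P) : y ∈ orderIdealSpan (P ⊔ ℝ ∙ d) := by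
    by_contra hyd
    refine hdP (hmax ⟨isOrderIdeal_orderIdealSpan _, hyd⟩ (fun x hx => ?_)
      (mem_orderIdealSpan_of_nonneg hd (Submodule.mem_sup_right
        (Submodule.mem_span_singleton_self d))))
    exact ⟨|x|, Submodule.mem_sup_left (hP.abs_mem hx), le_rfl⟩
  by_contra! hnot
  exact hyP (hP.mem_of_mem_orderIdealSpan_sup hab (mem_span (hab ▸ inf_le_left) hnot.1)
    (mem_span (hab ▸ inf_le_right) hnot.2))

end OrderIdeals

section LatticeCharacters

variable {A : Type*} [AddCommGroup A] [Lattice A] [IsOrderedAddMonoid A] [Module ℝ A]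
  [IsOrderedModule ℝ A]

/-- A real-valued lattice homomorphism of the principal ideal of `e`, normalised at `e`. It is
encoded as a linear functional on the whole space, of which only the values on the ideal matter. -/
structure LatticeCharacter (e : A) extends A →ₗ[ℝ] ℝ where
  map_unit' : toFun e = 1
  map_abs' : ∀ a ∈ principalIdeal e, toFun |a| = |toFun a|

namespace LatticeCharacter

variable {e a b : A} (τ : LatticeCharacter e)

instance : FunLike (LatticeCharacter e) A ℝ where
  coe τ := τ.toFun
  coe_injective τ σ h := by
    cases τ
    cases σ
    congr
    exact DFunLike.coe_injective h

instance : LinearMapClass (LatticeCharacter e) ℝ A ℝ where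
  map_add τ := τ.map_add'
  map_smulₛₗ τ := τ.map_smul'

theorem map_unit : τ e = 1 :=
  τ.map_unit'

theorem map_abs (ha : a ∈ principalIdeal e) : τ |a| = |τ a| :=
  τ.map_abs' a ha

theorem map_smul_unit (r : ℝ) : τ (r • e) = r := by
  rw [map_smul, map_unit, smul_eq_mul, mul_one]

theorem map_nonneg (ha : a ∈ principalIdeal e) (ha0 : 0 ≤ a) : 0 ≤ τ a := by
  rw [← abs_of_nonneg ha0, τ.map_abs ha]
  exact abs_nonneg _

theorem map_mono (ha : a ∈ principalIdeal e) (hb : b ∈ principalIdeal e) (hab : a ≤ b) :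
    τ a ≤ τ b := by
  rw [← sub_nonneg, ← map_sub]
  exact τ.map_nonneg (sub_mem hb ha) (sub_nonneg.2 hab)

theorem abs_map_le_one (ha : |a| ≤ e) : |τ a| ≤ 1 := by
  have ha' := mem_principalIdeal_of_abs_le ha
  rw [← τ.map_abs ha', ← τ.map_unit]
  exact τ.map_mono ((isOrderIdeal_principalIdeal e).abs_mem ha')
    (self_mem_principalIdeal ((abs_nonneg a).trans ha)) ha

theorem map_posPart (ha : a ∈ principalIdeal e) : τ a⁺ = (τ a)⁺ := by
  have h := congrArg τ (posPart_add_negPart a)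
  have h' := congrArg τ (posPart_sub_negPart a)
  rw [map_add, τ.map_abs ha, ← posPart_add_negPart (τ a)] at h
  rw [map_sub] at h'
  linarith [posPart_sub_negPart (τ a)]

theorem map_inf (ha : a ∈ principalIdeal e) (hb : b ∈ principalIdeal e) :
    τ (a ⊓ b) = τ a ⊓ τ b := by
  rw [inf_eq_sub_posPart_sub, map_sub, τ.map_posPart (sub_mem ha hb), map_sub,
    ← inf_eq_sub_posPart_sub]

theorem map_sup (ha : a ∈ principalIdeal e) (hb : b ∈ principalIdeal e) :
    τ (a ⊔ b) = τ a ⊔ τ b := by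
  rw [sup_eq_add_posPart_sub, map_add, τ.map_posPart (sub_mem ha hb), map_sub,
    ← sup_eq_add_posPart_sub]

theorem eq_zero_or_eq_zero (ha : a ∈ principalIdeal e) (hb : b ∈ principalIdeal e)
    (hab : a ⊓ b = 0) : τ a = 0 ∨ τ b = 0 := by
  have h := τ.map_inf ha hb
  rw [hab, map_zero] at h
  exact (min_choice (τ a) (τ b)).imp (fun hmin => hmin.symm.trans h.symm)
    fun hmin => hmin.symm.trans h.symm

end LatticeCharacter

/-- The elements that are infinitesimal relative to `e` modulo `P`. For a prime order ideal `P`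
they form the kernel of a character of the principal ideal of `e`. -/
def infinitesimals (P : Submodule ℝ A) (e : A) : Submodule ℝ A where
  carrier := {v | ∀ ε : ℝ, 0 < ε → ∃ q ∈ P, |v| ≤ q + ε • |e|}
  zero_mem' ε hε := ⟨0, zero_mem P, by
    rw [abs_zero, zero_add]
    exact smul_nonneg hε.le (abs_nonneg e)⟩
  add_mem' := by
    intro v w hv hw ε hε
    obtain ⟨q, hq, hvq⟩ := hv (ε / 2) (half_pos hε)
    obtain ⟨r, hr, hwr⟩ := hw (ε / 2) (half_pos hε)
    refine ⟨q + r, add_mem hq hr, (abs_add_le v w).trans ((add_le_add hvq hwr).trans_eq ?_)⟩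
    module
  smul_mem' := by
    intro r v hv ε hε
    obtain ⟨q, hq, hvq⟩ := hv (ε / (|r| + 1)) (by positivity)
    refine ⟨|r| • q, P.smul_mem _ hq, (abs_smul_eq_smul_abs r v).trans_le
      ((smul_le_smul_of_nonneg_left hvq (abs_nonneg r)).trans ?_)⟩
    rw [smul_add, smul_smul]
    gcongr
    calc |r| * (ε / (|r| + 1)) ≤ (|r| + 1) * (ε / (|r| + 1)) := by gcongr; linarith
      _ = ε := by field_simp

section Infinitesimals

variable {P : Submodule ℝ A} {e v : A}

theorem isOrderIdeal_infinitesimals : IsOrderIdeal (infinitesimals P e) := by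
  intro v hv w hwv ε hε
  obtain ⟨q, hq, hvq⟩ := hv ε hε
  exact ⟨q, hq, hwv.trans hvq⟩

theorem IsOrderIdeal.le_infinitesimals (hP : IsOrderIdeal P) : P ≤ infinitesimals P e :=
  fun q hq _ hε => ⟨|q|, hP.abs_mem hq,
    le_add_of_nonneg_right (smul_nonneg hε.le (abs_nonneg e))⟩

theorem IsOrderIdeal.unit_notMem_infinitesimals (hP : IsOrderIdeal P) (heP : e ∉ P) :
    e ∉ infinitesimals P e := by
  intro he
  obtain ⟨q, hq, heq⟩ := he (1 / 2) one_half_pos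
  have hle : (1 / 2 : ℝ) • |e| ≤ q := by
    rw [← sub_le_iff_le_add] at heq
    convert heq using 1
    module
  have hmem : (1 / 2 : ℝ) • |e| ∈ P :=
    hP.mem_of_nonneg_of_le hq (smul_nonneg one_half_pos.le (abs_nonneg e)) hle
  exact heP (hP ((P.smul_mem_iff one_half_pos.ne').1 hmem) (abs_abs e).ge)

theorem sub_smul_mem_infinitesimals (he : 0 ≤ e) (r : ℝ)
    (hlt : ∀ s < r, ∃ t > s, (t • e - v)⁺ ∈ P) (hgt : ∀ s > r, (v - s • e)⁺ ∈ P) :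
    v - r • e ∈ infinitesimals P e := by
  intro ε hε
  obtain ⟨t, ht, htP⟩ := hlt (r - ε) (sub_lt_self r hε)
  refine ⟨_, add_mem htP (hgt (r + ε) (lt_add_of_pos_right r hε)), ?_⟩
  rw [abs_of_nonneg he, abs_le']
  constructor
  · calc v - r • e = (v - (r + ε) • e) + ε • e := by module
      _ ≤ (t • e - v)⁺ + (v - (r + ε) • e)⁺ + ε • e := by
        gcongr
        exact (le_posPart _).trans (le_add_of_nonneg_left (posPart_nonneg _))
  · calc -(v - r • e) = (t • e - v) + (r - t) • e := by module
      _ ≤ (t • e - v)⁺ + (v - (r + ε) • e)⁺ + ε • e := by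
        refine add_le_add ((le_posPart _).trans (le_add_of_nonneg_right (posPart_nonneg _))) ?_
        exact smul_le_smul_of_nonneg_right (by linarith) he

theorem IsPrimeOrderIdeal.exists_sub_smul_mem_infinitesimals (hP : IsPrimeOrderIdeal P)
    (he : 0 ≤ e) (heP : e ∉ P) (hv : v ∈ principalIdeal e) :
    ∃ r : ℝ, v - r • e ∈ infinitesimals P e := by
  obtain ⟨c, hc⟩ := mem_principalIdeal.1 hv
  let S : Set ℝ := {t | (t • e - v)⁺ ∈ P}
  have hS : -c ∈ S := by
    have hle : (-c) • e - v ≤ 0 := by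
      rw [neg_smul, sub_nonpos]
      exact neg_le.1 ((neg_le_abs v).trans hc)
    rw [Set.mem_ofPred_eq, posPart_eq_zero.2 hle]
    exact zero_mem P
  have hbdd : BddAbove S := by
    refine ⟨c, fun t ht => not_lt.1 fun hct => heP ?_⟩
    have hle : (t - c) • e ≤ (t • e - v)⁺ := by
      refine le_trans ?_ (le_posPart _)
      rw [sub_smul]
      exact sub_le_sub_left ((le_abs_self v).trans hc) _
    exact (P.smul_mem_iff (sub_pos.2 hct).ne').1
      (hP.isOrderIdeal.mem_of_nonneg_of_le ht (smul_nonneg (sub_pos.2 hct).le he) hle)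
  refine ⟨sSup S, sub_smul_mem_infinitesimals he _
    (fun s hs => (exists_lt_of_lt_csSup ⟨_, hS⟩ hs).imp fun t ht => ht.symm) fun s hs => ?_⟩
  rw [← neg_sub, posPart_neg]
  exact (hP.mem_or_mem _ _ (posPart_inf_negPart_eq_zero _)).resolve_left
    fun hsS => (le_csSup hbdd hsS).not_gt hs

theorem IsPrimeOrderIdeal.exists_character_eq_zero (hP : IsPrimeOrderIdeal P) (he : 0 ≤ e)
    (heP : e ∉ P) : ∃ τ : LatticeCharacter e, ∀ v ∈ P, τ v = 0 := by
  have hPI := hP.isOrderIdeal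
  obtain ⟨f, hfe, hf⟩ :=
    Submodule.exists_le_ker_of_notMem (hPI.unit_notMem_infinitesimals heP)
  let φ : A →ₗ[ℝ] ℝ := (f e)⁻¹ • f
  have φ_unit : φ e = 1 := inv_mul_cancel₀ hfe
  have φ_eq_zero {v : A} (hv : v ∈ infinitesimals P e) : φ v = 0 := by
    rw [LinearMap.smul_apply, hf hv, smul_zero]
  have φ_eq {v : A} {r : ℝ} (hv : v - r • e ∈ infinitesimals P e) : φ v = r := by
    have := φ_eq_zero hv
    rwa [map_sub, map_smul, φ_unit, smul_eq_mul, mul_one, sub_eq_zero] at this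
  refine ⟨⟨φ, φ_unit, fun v hv => ?_⟩, fun v hv => φ_eq_zero (hPI.le_infinitesimals hv)⟩
  obtain ⟨r, hr⟩ := hP.exists_sub_smul_mem_infinitesimals he heP hv
  change φ |v| = |φ v|
  rw [φ_eq hr]
  refine φ_eq (isOrderIdeal_infinitesimals hr ?_)
  rw [← abs_of_nonneg he, ← abs_smul_eq_smul_abs, abs_of_nonneg he]
  exact abs_abs_sub_abs_le v (r • e)

end Infinitesimals

section Separation

variable (hArch : IsArchimedeanLattice A) {e x y : A}
include hArch

theorem exists_character_pos (he : 0 ≤ e) (hx : x ∈ principalIdeal e) (hx0 : 0 ≤ x)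
    (hne : x ≠ 0) : ∃ τ : LatticeCharacter e, 0 < τ x := by
  obtain ⟨n, hn⟩ : ∃ n : ℕ, ¬ n • x ≤ e := by
    by_contra! hle
    exact hne (hArch x e hx0 he hle)
  have hpos : (n • x - e)⁺ ≠ 0 := by
    rwa [Ne, posPart_eq_zero, sub_nonpos]
  obtain ⟨P, hP, hnP⟩ := exists_isPrimeOrderIdeal_notMem hpos
  have heP : e ∉ P := by
    obtain ⟨c, hc⟩ := mem_principalIdeal.1 hx
    refine fun heP => hnP (hP.isOrderIdeal.posPart_mem (sub_mem (nsmul_mem ?_ n) heP))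
    exact hP.isOrderIdeal.mem_of_nonneg_of_le (P.smul_mem c heP) hx0
      ((le_abs_self x).trans hc)
  obtain ⟨τ, hτ⟩ := hP.exists_character_eq_zero he heP
  refine ⟨τ, pos_of_mul_pos_right (zero_lt_one.trans_le ?_) n.cast_nonneg⟩
  have hmem : n • x - e ∈ principalIdeal e := sub_mem (nsmul_mem hx n) (self_mem_principalIdeal he)
  have hneg : τ (e - n • x)⁺ = 0 := by
    rw [← neg_sub, posPart_neg]
    exact hτ _ ((hP.mem_or_mem _ _ (posPart_inf_negPart_eq_zero _)).resolve_left hnP)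
  rw [τ.map_posPart (neg_sub (n • x) e ▸ neg_mem hmem), posPart_eq_zero, map_sub, τ.map_unit,
    map_nsmul, nsmul_eq_mul, sub_nonpos] at hneg
  exact hneg

theorem le_of_forall_character (he : 0 ≤ e) (hx : x ∈ principalIdeal e)
    (hy : y ∈ principalIdeal e) (h : ∀ τ : LatticeCharacter e, τ x ≤ τ y) : x ≤ y := by
  rw [← sub_nonpos, ← posPart_eq_zero]
  by_contra hne
  obtain ⟨τ, hτ⟩ := exists_character_pos hArch he
    ((isOrderIdeal_principalIdeal e).posPart_mem (sub_mem hx hy)) (posPart_nonneg _) hne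
  rw [τ.map_posPart (sub_mem hx hy), map_sub, posPart_pos_iff, sub_pos] at hτ
  exact (h τ).not_gt hτ

end Separation

section Proportionality

variable {e f v : A} (τ : LatticeCharacter e) {μ : A →ₗ[ℝ] ℝ}

theorem LatticeCharacter.map_nonpos_of_disjoint (he : 0 ≤ e)
    (hμ : ∀ a ∈ principalIdeal e, 0 ≤ a → 0 ≤ μ a)
    (hdisj : ∀ a ∈ principalIdeal e, ∀ b ∈ principalIdeal e, a ⊓ b = 0 → μ a = 0 ∨ τ b = 0)
    (hv : v ∈ principalIdeal e) (hτv : τ v ≤ 0) : μ v ≤ 0 := by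
  have hI := isOrderIdeal_principalIdeal e
  have hee := self_mem_principalIdeal he
  have hle {ε : ℝ} (hε : 0 < ε) : μ v ≤ ε * μ e := by
    have hw : v - ε • e ∈ principalIdeal e := sub_mem hv (Submodule.smul_mem _ ε hee)
    have hτw : 0 < τ (v - ε • e)⁻ := by
      rw [← posPart_neg, τ.map_posPart (neg_mem hw), posPart_pos_iff, map_neg, map_sub,
        τ.map_smul_unit]
      linarith
    have hμw : μ (v - ε • e)⁺ = 0 :=
      (hdisj _ (hI.posPart_mem hw) _ (hI.negPart_mem hw)
        (posPart_inf_negPart_eq_zero _)).resolve_right hτw.ne'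
    have hsub := hμ _ (hI.negPart_mem hw) (negPart_nonneg _)
    have hsplit := congrArg μ (posPart_sub_negPart (v - ε • e))
    rw [map_sub, map_sub, map_smul, smul_eq_mul, hμw] at hsplit
    linarith
  have hμe : 0 ≤ μ e := hμ e hee he
  refine le_of_forall_pos_le_add fun δ hδ => (hle (ε := δ / (μ e + 1)) (by positivity)).trans ?_
  rw [zero_add, div_mul_eq_mul_div, div_le_iff₀ (by positivity)]
  nlinarith

theorem LatticeCharacter.eq_mul_of_disjoint (he : 0 ≤ e)
    (hμ : ∀ a ∈ principalIdeal e, 0 ≤ a → 0 ≤ μ a)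
    (hdisj : ∀ a ∈ principalIdeal e, ∀ b ∈ principalIdeal e, a ⊓ b = 0 → μ a = 0 ∨ τ b = 0)
    (hf : f ∈ principalIdeal e) : μ f = μ e * τ f := by
  have hv : f - τ f • e ∈ principalIdeal e :=
    sub_mem hf (Submodule.smul_mem _ _ (self_mem_principalIdeal he))
  have hτv : τ (f - τ f • e) = 0 := by
    rw [map_sub, τ.map_smul_unit, sub_self]
  have hle := τ.map_nonpos_of_disjoint he hμ hdisj hv hτv.le
  have hge := τ.map_nonpos_of_disjoint he hμ hdisj (neg_mem hv) (by rw [map_neg, hτv, neg_zero])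
  rw [map_neg] at hge
  rw [map_sub, map_smul, smul_eq_mul] at hle hge
  linarith

end Proportionality

end LatticeCharacters

section FAlgebras

variable {A : Type*} [NonUnitalRing A]

theorem finProd_add_two (n : ℕ) (f : Fin (n + 2) → A) :
    finProd (n + 2) f = finProd (n + 1) (fun i => f i.castSucc) * f (Fin.last (n + 1)) := rfl

theorem finProd_snoc (n : ℕ) (f : Fin (n + 1) → A) (a : A) :
    finProd (n + 2) (Fin.snoc f a) = finProd (n + 1) f * a := by
  simp only [finProd_add_two, Fin.snoc_castSucc, Fin.snoc_last]

variable [Lattice A] [IsFAlgebra A] {a b c d e x y : A}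

namespace IsFAlgebra

theorem mul_inf_mul_eq_zero_of_right (hab : a ⊓ b = 0) (hc : 0 ≤ c) (hd : 0 ≤ d) :
    (c * a) ⊓ (d * b) = 0 := by
  rw [inf_comm]
  exact mul_left_inf _ _ _ (inf_comm (c * a) b ▸ mul_left_inf _ _ _ hab hc) hd

theorem mul_inf_mul_eq_zero_of_left (hab : a ⊓ b = 0) (hc : 0 ≤ c) (hd : 0 ≤ d) :
    (a * c) ⊓ (b * d) = 0 := by
  rw [inf_comm]
  exact mul_right_inf _ _ _ (inf_comm (a * c) b ▸ mul_right_inf _ _ _ hab hc) hd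

theorem mul_inf_mul_eq_zero_of_cross (hab : a ⊓ b = 0) (hc : 0 ≤ c) (hd : 0 ≤ d) :
    (a * c) ⊓ (d * b) = 0 := by
  rw [inf_comm]
  exact mul_left_inf _ _ _ (inf_comm (a * c) b ▸ mul_right_inf _ _ _ hab hc) hd

variable [IsOrderedAddMonoid A]

instance toPosMulMono : PosMulMono A where
  mul_le_mul_of_nonneg_left c hc a b hab := by
    have := mul_nonneg' c (b - a) hc (sub_nonneg.2 hab)
    rwa [mul_sub, sub_nonneg] at this

instance toMulPosMono : MulPosMono A where
  mul_le_mul_of_nonneg_right c hc a b hab := by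
    have := mul_nonneg' (b - a) c (sub_nonneg.2 hab) hc
    rwa [sub_mul, sub_nonneg] at this

theorem abs_mul (x y : A) : |x * y| = |x| * |y| := by
  have hx := posPart_inf_negPart_eq_zero x
  have hy := posPart_inf_negPart_eq_zero y
  have hx₀ := posPart_nonneg x
  have hx₁ := negPart_nonneg x
  have hy₀ := posPart_nonneg y
  have hy₁ := negPart_nonneg y
  have hdisj : (x⁺ * y⁺ + x⁻ * y⁻) ⊓ (x⁺ * y⁻ + x⁻ * y⁺) = 0 := by
    refine add_inf_eq_zero ?_ ?_ <;> rw [inf_comm] <;> refine add_inf_eq_zero ?_ ?_ <;>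
      rw [inf_comm]
    · exact mul_inf_mul_eq_zero_of_right hy hx₀ hx₀
    · exact mul_inf_mul_eq_zero_of_left hx hy₀ hy₀
    · exact inf_comm (x⁻ * y⁻) _ ▸ mul_inf_mul_eq_zero_of_left hx hy₁ hy₁
    · exact inf_comm (x⁻ * y⁻) _ ▸ mul_inf_mul_eq_zero_of_right hy hx₁ hx₁
  have hmul : x * y = (x⁺ * y⁺ + x⁻ * y⁻) - (x⁺ * y⁻ + x⁻ * y⁺) := by
    conv_lhs => rw [← posPart_sub_negPart x, ← posPart_sub_negPart y]
    noncomm_ring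
  rw [hmul, abs_sub_eq_add_of_inf_eq_zero hdisj, ← posPart_add_negPart x,
    ← posPart_add_negPart y]
  noncomm_ring

theorem posPart_mul_of_nonneg (hc : 0 ≤ c) (a : A) : (c * a)⁺ = c * a⁺ := by
  conv_lhs => rw [← posPart_sub_negPart a, mul_sub]
  exact posPart_sub_eq_of_inf_eq_zero
    (mul_inf_mul_eq_zero_of_right (posPart_inf_negPart_eq_zero a) hc hc)

theorem abs_finProd : ∀ (n : ℕ) (f : Fin n → A), |finProd n f| = finProd n fun i => |f i|
  | 0, _ => abs_zero
  | 1, _ => rfl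
  | n + 2, f => by
    rw [finProd_add_two, finProd_add_two, abs_mul, abs_finProd]

theorem abs_finPow (n : ℕ) (a : A) : |finPow n a| = finPow n |a| :=
  abs_finProd n _

theorem finPow_nonneg (n : ℕ) (ha : 0 ≤ a) : 0 ≤ finPow n a := by
  rw [← abs_of_nonneg ha, ← abs_finPow]
  exact abs_nonneg _

theorem finPow_inf_eq_zero (hab : a ⊓ b = 0) : ∀ n : ℕ, finPow (n + 1) a ⊓ b = 0
  | 0 => hab
  | _ + 1 => mul_left_inf _ _ _ hab (finPow_nonneg _ (hab ▸ inf_le_left))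

variable [Module ℝ A] [IsOrderedModule ℝ A] [IsScalarTower ℝ A A] [SMulCommClass ℝ A A]

theorem mul_mem_principalIdeal (hx : x ∈ principalIdeal d) (hy : y ∈ principalIdeal e) :
    x * y ∈ principalIdeal (d * e) := by
  obtain ⟨r, hr⟩ := mem_principalIdeal.1 hx
  obtain ⟨s, hs⟩ := mem_principalIdeal.1 hy
  refine mem_principalIdeal.2 ⟨r * s, ?_⟩
  calc |x * y| = |x| * |y| := abs_mul x y
    _ ≤ (r • d) * (s • e) :=
      mul_le_mul hr hs (abs_nonneg y) ((abs_nonneg x).trans hr)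
    _ = (r * s) • (d * e) := smul_mul_smul_comm r d s e

theorem finProd_mem_principalIdeal : ∀ (n : ℕ) (f : Fin n → A),
    (∀ i, f i ∈ principalIdeal e) → finProd n f ∈ principalIdeal (finPow n e)
  | 0, _, _ => zero_mem _
  | 1, _, h => h 0
  | n + 2, _, h =>
    mul_mem_principalIdeal (finProd_mem_principalIdeal (n + 1) _ fun i => h i.castSucc) (h _)

theorem finPow_mem_principalIdeal (n : ℕ) (ha : a ∈ principalIdeal e) :
    finPow n a ∈ principalIdeal (finPow n e) :=
  finProd_mem_principalIdeal n _ fun _ => ha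

end IsFAlgebra

end FAlgebras

section PowerCharacters

variable {A : Type*} [NonUnitalRing A] [Lattice A] [IsOrderedAddMonoid A] [Module ℝ A]
  [IsOrderedModule ℝ A] {a b d e x y : A}

namespace LatticeCharacter

/-- `ω`, a character of the ideal of `eⁿ`, is the `n`-th power of `τ`, a character of the ideal
of `e`, in the sense that `ω (f₁ ⋯ fₙ) = τ f₁ ⋯ τ fₙ`. -/
def IsPower (n : ℕ) (ω : LatticeCharacter (finPow n e)) (τ : LatticeCharacter e) : Prop :=
  ∀ f : Fin n → A, (∀ i, f i ∈ principalIdeal e) → ω (finProd n f) = ∏ i, τ (f i)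

namespace IsPower

variable {n : ℕ} {τ : LatticeCharacter e}

theorem map_finPow {ω : LatticeCharacter (finPow n e)} (h : IsPower n ω τ)
    (ha : a ∈ principalIdeal e) : ω (finPow n a) = τ a ^ n :=
  (h _ fun _ => ha).trans (Fin.prod_const n (τ a))

theorem map_finPow_mul {ω : LatticeCharacter (finPow (n + 2) e)} (h : IsPower (n + 2) ω τ)
    (ha : a ∈ principalIdeal e) (hb : b ∈ principalIdeal e) :
    ω (finPow (n + 1) a * b) = τ a ^ (n + 1) * τ b := by
  have hmem (i : Fin (n + 2)) :
      (Fin.snoc (fun _ => a) b : Fin (n + 2) → A) i ∈ principalIdeal e := by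
    induction i using Fin.lastCases with
    | last => rwa [Fin.snoc_last]
    | cast i => rwa [Fin.snoc_castSucc]
  have hprod := h _ hmem
  rw [finProd_snoc, Fin.prod_univ_castSucc] at hprod
  simpa only [Fin.snoc_castSucc, Fin.snoc_last, Fin.prod_const, finPow] using hprod

end IsPower

variable [IsScalarTower ℝ A A] [SMulCommClass ℝ A A] [IsFAlgebra A]

open IsFAlgebra

/-- The character `y ↦ ω (d * y)`. -/
def compMulLeft (ω : LatticeCharacter (d * e)) (hd : 0 ≤ d) : LatticeCharacter e where
  toLinearMap := ω.toLinearMap ∘ₗ LinearMap.mulLeft ℝ d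
  map_unit' := ω.map_unit
  map_abs' a ha := by
    change ω (d * |a|) = |ω (d * a)|
    rw [← ω.map_abs (mul_mem_principalIdeal (self_mem_principalIdeal hd) ha), IsFAlgebra.abs_mul,
      abs_of_nonneg hd]

/-- The character `x ↦ ω (x * e)`. -/
def compMulRight (ω : LatticeCharacter (d * e)) (he : 0 ≤ e) : LatticeCharacter d where
  toLinearMap := ω.toLinearMap ∘ₗ LinearMap.mulRight ℝ e
  map_unit' := ω.map_unit
  map_abs' a ha := by
    change ω (|a| * e) = |ω (a * e)|
    rw [← ω.map_abs (mul_mem_principalIdeal ha (self_mem_principalIdeal he)), IsFAlgebra.abs_mul,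
      abs_of_nonneg he]

theorem map_mul_of_nonneg (ω : LatticeCharacter (d * e)) (hd : 0 ≤ d) (he : 0 ≤ e)
    (hx : x ∈ principalIdeal d) (hx0 : 0 ≤ x) (hy : y ∈ principalIdeal e) :
    ω (x * y) = ω (x * e) * ω (d * y) := by
  refine (ω.compMulLeft hd).eq_mul_of_disjoint (μ := ω.toLinearMap ∘ₗ LinearMap.mulLeft ℝ x) he
    (fun a ha ha0 => ω.map_nonneg (mul_mem_principalIdeal hx ha) (mul_nonneg hx0 ha0))
    (fun a ha b hb hab => ?_) hy
  exact ω.eq_zero_or_eq_zero (mul_mem_principalIdeal hx ha)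
    (mul_mem_principalIdeal (self_mem_principalIdeal hd) hb)
    (mul_inf_mul_eq_zero_of_right hab hx0 hd)

theorem map_mul (ω : LatticeCharacter (d * e)) (hd : 0 ≤ d) (he : 0 ≤ e)
    (hx : x ∈ principalIdeal d) (hy : y ∈ principalIdeal e) :
    ω (x * y) = ω (x * e) * ω (d * y) := by
  have hI := isOrderIdeal_principalIdeal d
  rw [← posPart_sub_negPart x, sub_mul, sub_mul, map_sub, map_sub,
    ω.map_mul_of_nonneg hd he (hI.posPart_mem hx) (posPart_nonneg x) hy,
    ω.map_mul_of_nonneg hd he (hI.negPart_mem hx) (negPart_nonneg x) hy, sub_mul]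

namespace IsPower

variable {n : ℕ} {τ : LatticeCharacter e}

/-- The two ways of restricting `ω` to the ideal of `e` agree, because `ω` kills one of
`aⁿ⁺¹ e` and `eⁿ⁺¹ b` for disjoint `a` and `b`. -/
theorem map_finPow_unit_mul {ω : LatticeCharacter (finPow (n + 2) e)} (he : 0 ≤ e)
    (h : IsPower (n + 1) (ω.compMulRight (d := finPow (n + 1) e) he) τ)
    (hb : b ∈ principalIdeal e) : ω (finPow (n + 1) e * b) = τ b := by
  have hpos : 0 ≤ finPow (n + 1) e := finPow_nonneg _ he
  have hee := self_mem_principalIdeal he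
  symm
  have key := (ω.compMulLeft hpos).eq_mul_of_disjoint (μ := τ.toLinearMap) he
    (fun a ha ha0 => τ.map_nonneg ha ha0) (fun a ha b hb hab => ?_) hb
  · refine key.trans ?_
    change τ e * _ = _
    rw [τ.map_unit, one_mul]
    rfl
  · refine (ω.eq_zero_or_eq_zero
      (mul_mem_principalIdeal (finPow_mem_principalIdeal (n + 1) ha) hee)
      (mul_mem_principalIdeal (self_mem_principalIdeal hpos) hb) ?_).imp_left fun hzero => ?_
    · exact mul_inf_mul_eq_zero_of_cross (finPow_inf_eq_zero hab n) he hpos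
    · exact eq_zero_of_pow_eq_zero ((h.map_finPow ha).symm.trans hzero)

end IsPower

theorem exists_isPower (he : 0 ≤ e) : ∀ (n : ℕ) (ω : LatticeCharacter (finPow (n + 1) e)),
    ∃ τ, IsPower (n + 1) ω τ
  | 0, ω => ⟨ω, fun f _ => (Fin.prod_univ_one fun i => ω (f i)).symm⟩
  | n + 1, ω => by
    obtain ⟨τ, hτ⟩ := exists_isPower he n (ω.compMulRight (d := finPow (n + 1) e) he)
    refine ⟨τ, fun f hf => ?_⟩
    have hf' := finProd_mem_principalIdeal (n + 1) _ fun i : Fin (n + 1) => hf i.castSucc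
    calc ω (finProd (n + 2) f)
      _ = ω (finProd (n + 1) (fun i => f i.castSucc) * e) *
          ω (finPow (n + 1) e * f (Fin.last (n + 1))) :=
        LatticeCharacter.map_mul ω (finPow_nonneg _ he) he hf' (hf _)
      _ = (∏ i : Fin (n + 1), τ (f i.castSucc)) * τ (f (Fin.last (n + 1))) :=
        congrArg₂ _ (hτ _ fun i => hf i.castSucc) (hτ.map_finPow_unit_mul he (hf _))
      _ = ∏ i, τ (f i) :=
        (Fin.prod_univ_castSucc fun i => τ (f i)).symm

end LatticeCharacter

section Separation

open IsFAlgebra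

variable [IsScalarTower ℝ A A] [SMulCommClass ℝ A A] [IsFAlgebra A]
  (hArch : IsArchimedeanLattice A) (n : ℕ) (he : 0 ≤ e)
include hArch he

theorem le_of_forall_isPower (hx : x ∈ principalIdeal (finPow (n + 1) e))
    (hy : y ∈ principalIdeal (finPow (n + 1) e))
    (h : ∀ (ω : LatticeCharacter (finPow (n + 1) e)) (τ : LatticeCharacter e),
      ω.IsPower (n + 1) τ → ω x ≤ ω y) : x ≤ y := by
  refine le_of_forall_character hArch (finPow_nonneg _ he) hx hy fun ω => ?_
  obtain ⟨τ, hτ⟩ := LatticeCharacter.exists_isPower he n ω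
  exact h ω τ hτ

theorem eq_of_forall_isPower (hx : x ∈ principalIdeal (finPow (n + 1) e))
    (hy : y ∈ principalIdeal (finPow (n + 1) e))
    (h : ∀ (ω : LatticeCharacter (finPow (n + 1) e)) (τ : LatticeCharacter e),
      ω.IsPower (n + 1) τ → ω x = ω y) : x = y :=
  le_antisymm (le_of_forall_isPower hArch n he hx hy fun ω τ hτ => (h ω τ hτ).le)
    (le_of_forall_isPower hArch n he hy hx fun ω τ hτ => (h ω τ hτ).ge)

theorem IsSemiprimeAlgebra.le_of_forall_isPower (hs : IsSemiprimeAlgebra A)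
    (hx : x ∈ principalIdeal e) (hy : y ∈ principalIdeal e)
    (h : ∀ (ω : LatticeCharacter (finPow (n + 1) e)) (τ : LatticeCharacter e),
      ω.IsPower (n + 1) τ → τ x ≤ τ y) : x ≤ y := by
  have hxy := sub_mem hx hy
  have hpos := (isOrderIdeal_principalIdeal e).posPart_mem hxy
  rw [← sub_nonpos, ← posPart_eq_zero]
  refine hs _ ⟨n + 1, n.succ_pos, eq_of_forall_isPower hArch n he
    (finPow_mem_principalIdeal _ hpos) (zero_mem _) fun ω τ hτ => ?_⟩
  rw [hτ.map_finPow hpos, τ.map_posPart hxy, map_sub, posPart_eq_zero.2 (sub_nonpos.2 (h ω τ hτ)),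
    zero_pow n.succ_ne_zero, map_zero]

end Separation

end PowerCharacters

section FunctionalCalculus

variable {A : Type*} [AddCommGroup A] [Lattice A] [IsOrderedAddMonoid A] [Module ℝ A]
  [IsOrderedModule ℝ A] {e : A} {ι : Type*} {g : ι → A}

theorem exists_forall_character_eq_of_tendstoUniformly (hArch : IsArchimedeanLattice A)
    (hUnif : IsUniformlyComplete A) (he : 0 ≤ e) {s : ℕ → A} (hs : ∀ n, s n ∈ principalIdeal e)
    {φ : LatticeCharacter e → ℝ}
    (hφ : TendstoUniformly (fun n (τ : LatticeCharacter e) => τ (s n)) φ Filter.atTop) :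
    ∃ x ∈ principalIdeal e, ∀ τ : LatticeCharacter e, τ x = φ τ := by
  have hI := isOrderIdeal_principalIdeal e
  have hee := self_mem_principalIdeal he
  have hcauchy : ∀ ε : ℝ, 0 < ε → ∃ N, ∀ m n, N ≤ m → N ≤ n → |s m - s n| ≤ ε • e := by
    intro ε hε
    obtain ⟨N, hN⟩ := Filter.eventually_atTop.1 (Metric.tendstoUniformly_iff.1 hφ _ (half_pos hε))
    refine ⟨N, fun m n hm hn => le_of_forall_character hArch he
      (hI.abs_mem (sub_mem (hs m) (hs n))) (Submodule.smul_mem _ ε hee) fun τ => ?_⟩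
    rw [τ.map_abs (sub_mem (hs m) (hs n)), map_sub, τ.map_smul_unit, ← Real.dist_eq,
      ← add_halves ε]
    exact (dist_triangle_left _ _ (φ τ)).trans (add_le_add (hN m hm τ).le (hN n hn τ).le)
  obtain ⟨x, hx⟩ := hUnif e he s hcauchy
  have hxe : x ∈ principalIdeal e := by
    obtain ⟨N, hN⟩ := hx 1 one_pos
    rw [← sub_sub_self (s N) x]
    exact sub_mem (hs N) (mem_principalIdeal.2 ⟨1, hN N le_rfl⟩)
  refine ⟨x, hxe, fun τ => tendsto_nhds_unique ?_ (hφ.tendsto_at τ)⟩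
  refine Metric.tendsto_atTop'.2 fun ε hε => ?_
  obtain ⟨N, hN⟩ := hx (ε / 2) (half_pos hε)
  refine ⟨N, fun n hn => lt_of_le_of_lt ?_ (half_lt_self hε)⟩
  have hmem := sub_mem (hs n) hxe
  rw [Real.dist_eq, ← map_sub, ← τ.map_abs hmem, ← τ.map_smul_unit (ε / 2)]
  exact τ.map_mono (hI.abs_mem hmem) (Submodule.smul_mem _ _ hee) (hN n hn.le)

/-- The values of a character at a family of elements between `-e` and `e`, as a point of a
compact cube. -/
def LatticeCharacter.jointValue (hg : ∀ i, |g i| ≤ e) (τ : LatticeCharacter e) :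
    Set.Icc (-1 : ι → ℝ) 1 :=
  ⟨fun i => τ (g i), fun i => (abs_le.1 (τ.abs_map_le_one (hg i))).1,
    fun i => (abs_le.1 (τ.abs_map_le_one (hg i))).2⟩

/-- The continuous functions `F` for which the principal ideal of `e` contains an element that
deserves the name `F (g)`. -/
def representable (hg : ∀ i, |g i| ≤ e) : Set C(Set.Icc (-1 : ι → ℝ) 1, ℝ) :=
  {F | ∃ a ∈ principalIdeal e, ∀ τ : LatticeCharacter e, τ a = F (τ.jointValue hg)}

theorem separatesPointsStrongly_representable (he : 0 ≤ e) (hg : ∀ i, |g i| ≤ e) :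
    (representable hg).SeparatesPointsStrongly := by
  intro v x y
  have hee := self_mem_principalIdeal he
  have affine_mem (i : ι) (c d : ℝ) :
      ContinuousMap.mk (fun z : Set.Icc (-1 : ι → ℝ) 1 => c + d * z.1 i) (continuous_const.add
          (continuous_const.mul ((continuous_apply i).comp continuous_subtype_val))) ∈
        representable hg := by
    refine ⟨c • e + d • g i, add_mem (Submodule.smul_mem _ _ hee)
      (Submodule.smul_mem _ _ (mem_principalIdeal_of_abs_le (hg i))), fun τ => ?_⟩
    rw [map_add, τ.map_smul_unit, map_smul, smul_eq_mul]
    rfl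
  by_cases hxy : x = y
  · subst hxy
    refine ⟨ContinuousMap.const _ (v x), ⟨v x • e, Submodule.smul_mem _ _ hee, ?_⟩, rfl, rfl⟩
    exact fun τ => τ.map_smul_unit _
  · obtain ⟨i, hi⟩ : ∃ i, x.1 i ≠ y.1 i := by
      by_contra! hall
      exact hxy (Subtype.ext (funext hall))
    have hne : y.1 i - x.1 i ≠ 0 := sub_ne_zero.2 hi.symm
    let slope : ℝ := (v y - v x) / (y.1 i - x.1 i)
    refine ⟨_, affine_mem i (v x - slope * x.1 i) slope, ?_, ?_⟩
    · exact sub_add_cancel _ _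
    · calc v x - slope * x.1 i + slope * y.1 i = v x + slope * (y.1 i - x.1 i) := by ring
        _ = v y := by rw [div_mul_cancel₀ _ hne, add_sub_cancel]

theorem isClosed_representable (hArch : IsArchimedeanLattice A) (hUnif : IsUniformlyComplete A)
    (he : 0 ≤ e) (hg : ∀ i, |g i| ≤ e) : IsClosed (representable hg) := by
  refine isClosed_of_closure_subset fun F hF => ?_
  obtain ⟨s, hs, hlim⟩ := mem_closure_iff_seq_limit.1 hF
  choose a ha hτa using hs
  refine exists_forall_character_eq_of_tendstoUniformly hArch hUnif he ha ?_
  simp only [hτa]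
  exact (ContinuousMap.tendsto_iff_tendstoUniformly.1 hlim).comp _

theorem representable_eq_univ (hArch : IsArchimedeanLattice A) (hUnif : IsUniformlyComplete A)
    (he : 0 ≤ e) (hg : ∀ i, |g i| ≤ e) : representable hg = Set.univ := by
  have hI := isOrderIdeal_principalIdeal e
  have htop := ContinuousMap.sublattice_closure_eq_top (representable hg)
    ⟨0, 0, zero_mem _, fun τ => map_zero τ⟩
    (by
      rintro F ⟨a, ha, hτa⟩ G ⟨b, hb, hτb⟩
      refine ⟨a ⊓ b, hI.inf_mem ha hb, fun τ => ?_⟩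
      rw [τ.map_inf ha hb, hτa, hτb, ContinuousMap.inf_apply])
    (by
      rintro F ⟨a, ha, hτa⟩ G ⟨b, hb, hτb⟩
      refine ⟨a ⊔ b, hI.sup_mem ha hb, fun τ => ?_⟩
      rw [τ.map_sup ha hb, hτa, hτb, ContinuousMap.sup_apply])
    (separatesPointsStrongly_representable he hg)
  rwa [(isClosed_representable hArch hUnif he hg).closure_eq] at htop

theorem exists_forall_character_eq (hArch : IsArchimedeanLattice A)
    (hUnif : IsUniformlyComplete A) (he : 0 ≤ e) (hg : ∀ i, |g i| ≤ e) {F : (ι → ℝ) → ℝ}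
    (hF : Continuous F) :
    ∃ a ∈ principalIdeal e, ∀ τ : LatticeCharacter e, τ a = F fun i => τ (g i) := by
  have hmem : ContinuousMap.mk (fun z : Set.Icc (-1 : ι → ℝ) 1 => F z) (by fun_prop) ∈
      representable hg := by
    rw [representable_eq_univ hArch hUnif he hg]
    exact Set.mem_univ _
  exact hmem

end FunctionalCalculus

section Products

/-- The odd extension of the `p`-th root to the real line. -/
noncomputable def signedRoot (p : ℕ) (r : ℝ) : ℝ :=
  r⁺ ^ (p : ℝ)⁻¹ - r⁻ ^ (p : ℝ)⁻¹

theorem continuous_signedRoot (p : ℕ) : Continuous (signedRoot p) := by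
  have hp : (0 : ℝ) ≤ (p : ℝ)⁻¹ := by positivity
  exact ((continuous_id.sup continuous_const).rpow_const fun _ => Or.inr hp).sub
    ((continuous_neg.sup continuous_const).rpow_const fun _ => Or.inr hp)

theorem signedRoot_neg (p : ℕ) (r : ℝ) : signedRoot p (-r) = -signedRoot p r := by
  rw [signedRoot, signedRoot, posPart_neg, negPart_neg, neg_sub]

theorem signedRoot_of_nonneg (n : ℕ) {r : ℝ} (hr : 0 ≤ r) :
    signedRoot (n + 1) r = r ^ ((n + 1 : ℕ) : ℝ)⁻¹ := by
  have hp : ((n + 1 : ℕ) : ℝ)⁻¹ ≠ 0 := by positivity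
  rw [signedRoot, posPart_eq_self.2 hr, negPart_eq_zero.2 hr, Real.zero_rpow hp, sub_zero]

theorem abs_signedRoot_pow_mul (n : ℕ) (r : ℝ) :
    |signedRoot (n + 1) r| ^ n * signedRoot (n + 1) r = r := by
  have of_nonneg {s : ℝ} (hs : 0 ≤ s) :
      |signedRoot (n + 1) s| ^ n * signedRoot (n + 1) s = s := by
    rw [signedRoot_of_nonneg n hs, abs_of_nonneg (Real.rpow_nonneg hs _), ← pow_succ,
      Real.rpow_inv_natCast_pow hs n.succ_ne_zero]
  rcases le_total 0 r with hr | hr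
  · exact of_nonneg hr
  · have hneg := of_nonneg (neg_nonneg.2 hr)
    rwa [signedRoot_neg, abs_neg, mul_neg, neg_inj] at hneg

section NonUnitalRing

variable {A : Type*} [NonUnitalRing A] {n : ℕ} {x : A}

theorem mem_productSet_add_two :
    x ∈ productSet A (n + 2) ↔ ∃ y ∈ productSet A (n + 1), ∃ a, x = y * a := by
  constructor
  · rintro ⟨f, rfl⟩
    exact ⟨_, ⟨_, rfl⟩, _, rfl⟩
  · rintro ⟨_, ⟨f, rfl⟩, a, rfl⟩
    exact ⟨_, (finProd_snoc n f a).symm⟩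

theorem mul_mem_productSet (hx : x ∈ productSet A (n + 2)) (b : A) :
    x * b ∈ productSet A (n + 2) := by
  obtain ⟨y, hy, a, rfl⟩ := mem_productSet_add_two.1 hx
  exact mem_productSet_add_two.2 ⟨y, hy, a * b, mul_assoc y a b⟩

theorem smul_mem_productSet [Module ℝ A] [SMulCommClass ℝ A A] (c : ℝ)
    (hx : x ∈ productSet A (n + 2)) : c • x ∈ productSet A (n + 2) := by
  obtain ⟨y, hy, a, rfl⟩ := mem_productSet_add_two.1 hx
  exact mem_productSet_add_two.2 ⟨y, hy, c • a, (mul_smul_comm c y a).symm⟩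

end NonUnitalRing

theorem abs_le_sum_abs {ι A : Type*} [Fintype ι] [AddCommGroup A] [Lattice A]
    [IsOrderedAddMonoid A] (f : ι → A) (i : ι) : |f i| ≤ ∑ j, |f j| :=
  Finset.single_le_sum (f := fun j => |f j|) (fun j _ => abs_nonneg (f j)) (Finset.mem_univ i)

variable {A : Type*} [NonUnitalRing A] [Lattice A] [IsOrderedAddMonoid A] [Module ℝ A]
  [IsOrderedModule ℝ A] [IsScalarTower ℝ A A] [SMulCommClass ℝ A A] [IsFAlgebra A]
  (hArch : IsArchimedeanLattice A) (hUnif : IsUniformlyComplete A) {n : ℕ} {x y : A}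
include hArch hUnif

open IsFAlgebra

theorem exists_add_eq_finPow_abs_mul (hx : x ∈ productSet A (n + 2))
    (hy : y ∈ productSet A (n + 2)) : ∃ φ : A, x + y = finPow (n + 1) |φ| * φ := by
  obtain ⟨g, rfl⟩ := hx
  obtain ⟨k, rfl⟩ := hy
  let f : Fin (n + 2) ⊕ Fin (n + 2) → A := Sum.elim g k
  let e : A := ∑ j, |f j|
  have he : 0 ≤ e := Finset.sum_nonneg fun j _ => abs_nonneg (f j)
  have hfe (j) : f j ∈ principalIdeal e := mem_principalIdeal_of_abs_le (abs_le_sum_abs f j)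
  have hge (i) : g i ∈ principalIdeal e := hfe (Sum.inl i)
  have hke (i) : k i ∈ principalIdeal e := hfe (Sum.inr i)
  obtain ⟨φ, hφ, hτφ⟩ := exists_forall_character_eq hArch hUnif he (abs_le_sum_abs f)
    (F := fun s => signedRoot (n + 2) (∏ i, s (Sum.inl i) + ∏ i, s (Sum.inr i)))
    ((continuous_signedRoot _).comp (by fun_prop))
  have habs := (isOrderIdeal_principalIdeal e).abs_mem hφ
  refine ⟨φ, eq_of_forall_isPower hArch (n + 1) he
    (add_mem (finProd_mem_principalIdeal _ g hge) (finProd_mem_principalIdeal _ k hke))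
    (mul_mem_principalIdeal (finPow_mem_principalIdeal (n + 1) habs) hφ) fun ω τ hτ => ?_⟩
  calc ω (finProd (n + 2) g + finProd (n + 2) k)
    _ = ∏ i, τ (g i) + ∏ i, τ (k i) := by rw [map_add, hτ g hge, hτ k hke]
    _ = |τ φ| ^ (n + 1) * τ φ := by rw [hτφ]; exact (abs_signedRoot_pow_mul _ _).symm
    _ = ω (finPow (n + 1) |φ| * φ) := by rw [hτ.map_finPow_mul habs hφ, τ.map_abs hφ]

theorem add_mem_productSet (hx : x ∈ productSet A (n + 2)) (hy : y ∈ productSet A (n + 2)) :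
    x + y ∈ productSet A (n + 2) := by
  obtain ⟨φ, hφ⟩ := exists_add_eq_finPow_abs_mul hArch hUnif hx hy
  exact mem_productSet_add_two.2 ⟨_, finPow_mem_productSet _ _, φ, hφ⟩

theorem sub_mem_productSet (hx : x ∈ productSet A (n + 2)) (hy : y ∈ productSet A (n + 2)) :
    x - y ∈ productSet A (n + 2) := by
  rw [sub_eq_add_neg, ← neg_one_smul ℝ y]
  exact add_mem_productSet hArch hUnif hx (smul_mem_productSet (-1) hy)

theorem exists_eq_finPow_abs_mul (hx : x ∈ productSet A (n + 2)) :
    ∃ φ : A, x = finPow (n + 1) |φ| * φ := by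
  have h := exists_add_eq_finPow_abs_mul hArch hUnif hx (smul_mem_productSet 0 hx)
  rwa [zero_smul, add_zero] at h

theorem exists_abs_eq_finPow_abs (hx : x ∈ productSet A (n + 2)) :
    ∃ φ : A, |x| = finPow (n + 2) |φ| := by
  obtain ⟨φ, rfl⟩ := exists_eq_finPow_abs_mul hArch hUnif hx
  refine ⟨φ, ?_⟩
  rw [IsFAlgebra.abs_mul, abs_finPow, abs_abs]
  rfl

theorem posPart_mem_productSet (hx : x ∈ productSet A (n + 2)) : x⁺ ∈ productSet A (n + 2) := by
  obtain ⟨φ, rfl⟩ := exists_eq_finPow_abs_mul hArch hUnif hx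
  rw [posPart_mul_of_nonneg (finPow_nonneg _ (abs_nonneg φ))]
  exact mem_productSet_add_two.2 ⟨_, finPow_mem_productSet _ _, φ⁺, rfl⟩

variable (n)

/-- The lattice subalgebra `Π_p(A)`, for `p = n + 2`. -/
def productSubalgebra : LatticeSubalgebra A where
  carrier := productSet A (n + 2)
  zero_mem' := by
    simpa only [zero_smul] using smul_mem_productSet 0 (finPow_mem_productSet (n + 2) (0 : A))
  add_mem' := add_mem_productSet hArch hUnif
  smul_mem' c _ hx := smul_mem_productSet c hx
  mul_mem' hx _ := mul_mem_productSet hx _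
  sup_mem' {x y} hx hy := by
    rw [sup_eq_add_posPart_sub x y]
    exact add_mem_productSet hArch hUnif hy
      (posPart_mem_productSet hArch hUnif (sub_mem_productSet hArch hUnif hx hy))
  inf_mem' {x y} hx hy := by
    rw [inf_eq_sub_posPart_sub x y]
    exact sub_mem_productSet hArch hUnif hx
      (posPart_mem_productSet hArch hUnif (sub_mem_productSet hArch hUnif hx hy))

end Products

section Majorants

theorem forall_inf_nsmul_le_iff_of_linearOrder {α : Type*} [AddCommMonoid α] [LinearOrder α]
    [Archimedean α] {a b c : α} (hb : 0 ≤ b) (hc : 0 ≤ c) :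
    (∀ k : ℕ, a ⊓ k • b ≤ c) ↔ (0 < b → a ≤ c) := by
  refine ⟨fun h hpos => ?_, fun h k => ?_⟩
  · obtain ⟨k, hk⟩ := Archimedean.arch a hpos
    exact (inf_eq_left.2 hk).ge.trans (h k)
  · rcases hb.eq_or_lt with rfl | hpos
    · exact inf_le_of_right_le ((smul_zero k).trans_le hc)
    · exact inf_le_of_left_le (h hpos)

section VectorLattices

variable {A : Type*} [AddCommGroup A] [Lattice A] [IsOrderedAddMonoid A] [Module ℝ A]
  [IsOrderedModule ℝ A] {e f g u : A}

theorem LatticeCharacter.forall_inf_nsmul_le_iff (τ : LatticeCharacter e)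
    (hf : f ∈ principalIdeal e) (hg : g ∈ principalIdeal e) (hu : u ∈ principalIdeal e)
    (hg0 : 0 ≤ g) (hu0 : 0 ≤ u) :
    (∀ k : ℕ, τ (f ⊓ k • g) ≤ τ u) ↔ (0 < τ g → τ f ≤ τ u) := by
  rw [← forall_inf_nsmul_le_iff_of_linearOrder (τ.map_nonneg hg hg0) (τ.map_nonneg hu hu0)]
  refine forall_congr' fun k => ?_
  rw [τ.map_inf hf (nsmul_mem hg k), map_nsmul]

theorem forall_inf_nsmul_le_iff_forall_character (hArch : IsArchimedeanLattice A) (he : 0 ≤ e)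
    (hf : f ∈ principalIdeal e) (hg : g ∈ principalIdeal e) (hu : u ∈ principalIdeal e)
    (hg0 : 0 ≤ g) (hu0 : 0 ≤ u) :
    (∀ k : ℕ, f ⊓ k • g ≤ u) ↔ ∀ τ : LatticeCharacter e, 0 < τ g → τ f ≤ τ u := by
  have hmem (k : ℕ) : f ⊓ k • g ∈ principalIdeal e :=
    (isOrderIdeal_principalIdeal e).inf_mem hf (nsmul_mem hg k)
  simp only [← LatticeCharacter.forall_inf_nsmul_le_iff _ hf hg hu hg0 hu0]
  exact ⟨fun h τ k => τ.map_mono (hmem k) hu (h k),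
    fun h k => le_of_forall_character hArch he (hmem k) hu fun τ => h τ k⟩

theorem exists_mem_principalIdeal₃ (f g u : A) :
    ∃ e : A, 0 ≤ e ∧ f ∈ principalIdeal e ∧ g ∈ principalIdeal e ∧ u ∈ principalIdeal e := by
  have h := fun i => mem_principalIdeal_of_abs_le (abs_le_sum_abs ![f, g, u] i)
  exact ⟨_, Finset.sum_nonneg fun i _ => abs_nonneg _, h 0, h 1, h 2⟩

end VectorLattices

theorem finPow_smul {A : Type*} [NonUnitalRing A] [Module ℝ A] [IsScalarTower ℝ A A]
    [SMulCommClass ℝ A A] (c : ℝ) (a : A) : ∀ n : ℕ, finPow n (c • a) = c ^ n • finPow n a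
  | 0 => (smul_zero _).symm
  | 1 => by rw [pow_one]; rfl
  | n + 2 => by
    change finPow (n + 1) (c • a) * (c • a) = c ^ (n + 2) • (finPow (n + 1) a * a)
    rw [finPow_smul c a (n + 1), smul_mul_smul_comm, ← pow_succ]

theorem LatticeSubalgebra.isMajorant_iff {A : Type*} [NonUnitalRing A] [Lattice A] [Module ℝ A]
    {P : LatticeSubalgebra A} {φ z : P} :
    IsMajorant φ z ↔ 0 ≤ (z : A) ∧ ∀ x ∈ P, ∃ c : ℝ, 0 < c ∧
      ∀ k : ℕ, |x| ⊓ k • |(φ : A)| ≤ c • (z : A) :=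
  ⟨fun h => ⟨h.1, fun x hx => h.2 ⟨x, hx⟩⟩, fun h => ⟨h.1, fun x => h.2 x x.2⟩⟩

variable {A : Type*} [NonUnitalRing A] [Lattice A] [IsOrderedAddMonoid A] [Module ℝ A]
  [IsOrderedModule ℝ A] [IsScalarTower ℝ A A] [SMulCommClass ℝ A A] [IsFAlgebra A]
  {n : ℕ} {f g u : A}

open IsFAlgebra

section Powers

variable (hArch : IsArchimedeanLattice A)
include hArch

theorem forall_inf_nsmul_finPow_le_iff {e : A} (he : 0 ≤ e) (hf : f ∈ principalIdeal e)
    (hg : g ∈ principalIdeal e) (hu : u ∈ principalIdeal e) (hf0 : 0 ≤ f) (hg0 : 0 ≤ g)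
    (hu0 : 0 ≤ u) :
    (∀ k : ℕ, finPow (n + 1) f ⊓ k • finPow (n + 1) g ≤ finPow (n + 1) u) ↔
      ∀ (ω : LatticeCharacter (finPow (n + 1) e)) (τ : LatticeCharacter e),
        ω.IsPower (n + 1) τ → 0 < τ g → τ f ≤ τ u := by
  have hpow {a : A} (ha : a ∈ principalIdeal e) := finPow_mem_principalIdeal (n + 1) ha
  rw [forall_inf_nsmul_le_iff_forall_character hArch (finPow_nonneg _ he) (hpow hf) (hpow hg)
    (hpow hu) (finPow_nonneg _ hg0) (finPow_nonneg _ hu0)]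
  have hpos (τ : LatticeCharacter e) : 0 < τ g ^ (n + 1) ↔ 0 < τ g := by
    rw [← pow_lt_pow_iff_left₀ le_rfl (τ.map_nonneg hg hg0) n.succ_ne_zero,
      zero_pow n.succ_ne_zero]
  have hiff (ω : LatticeCharacter (finPow (n + 1) e)) (τ : LatticeCharacter e)
      (hτ : ω.IsPower (n + 1) τ) :
      (0 < ω (finPow (n + 1) g) → ω (finPow (n + 1) f) ≤ ω (finPow (n + 1) u)) ↔
        (0 < τ g → τ f ≤ τ u) := by
    rw [hτ.map_finPow hf, hτ.map_finPow hg, hτ.map_finPow hu, hpos,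
      pow_le_pow_iff_left₀ (τ.map_nonneg hf hf0) (τ.map_nonneg hu hu0) n.succ_ne_zero]
  refine ⟨fun h ω τ hτ => (hiff ω τ hτ).1 (h ω), fun h ω => ?_⟩
  obtain ⟨τ, hτ⟩ := LatticeCharacter.exists_isPower he n ω
  exact (hiff ω τ hτ).2 (h ω τ hτ)

theorem forall_inf_nsmul_finPow_le (hf : 0 ≤ f) (hg : 0 ≤ g) (hu : 0 ≤ u)
    (h : ∀ k : ℕ, f ⊓ k • g ≤ u) (k : ℕ) :
    finPow (n + 1) f ⊓ k • finPow (n + 1) g ≤ finPow (n + 1) u := by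
  obtain ⟨e, he, hfe, hge, hue⟩ := exists_mem_principalIdeal₃ f g u
  refine (forall_inf_nsmul_finPow_le_iff hArch he hfe hge hue hf hg hu).2 (fun ω τ _ => ?_) k
  exact (forall_inf_nsmul_le_iff_forall_character hArch he hfe hge hue hg hu).1 h τ

theorem IsSemiprimeAlgebra.forall_inf_nsmul_le_of_finPow (hs : IsSemiprimeAlgebra A)
    (hf : 0 ≤ f) (hg : 0 ≤ g) (hu : 0 ≤ u)
    (h : ∀ k : ℕ, finPow (n + 1) f ⊓ k • finPow (n + 1) g ≤ finPow (n + 1) u) (k : ℕ) :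
    f ⊓ k • g ≤ u := by
  obtain ⟨e, he, hfe, hge, hue⟩ := exists_mem_principalIdeal₃ f g u
  refine hs.le_of_forall_isPower hArch n he
    ((isOrderIdeal_principalIdeal e).inf_mem hfe (nsmul_mem hge k)) hue fun ω τ hτ => ?_
  have hτ' := (forall_inf_nsmul_finPow_le_iff hArch he hfe hge hue hf hg hu).1 h ω τ hτ
  exact (τ.forall_inf_nsmul_le_iff hfe hge hue hg hu).2 hτ' k

end Powers

variable {P : LatticeSubalgebra A}

theorem IsMajorant.pow (hArch : IsArchimedeanLattice A) (hUnif : IsUniformlyComplete A)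
    (hP : (P : Set A) = productSet A (n + 2)) (h : IsMajorant g u) :
    IsMajorant (LatticeSubalgebra.pow hP g) (LatticeSubalgebra.pow hP u) := by
  refine LatticeSubalgebra.isMajorant_iff.2 ⟨finPow_nonneg _ h.1, fun x hx => ?_⟩
  obtain ⟨φ, hφ⟩ := exists_abs_eq_finPow_abs hArch hUnif (hP.subset hx)
  obtain ⟨c, hc, hle⟩ := h.2 φ
  refine ⟨c ^ (n + 2), pow_pos hc _, fun k => ?_⟩
  change |x| ⊓ k • |finPow (n + 2) g| ≤ c ^ (n + 2) • finPow (n + 2) u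
  rw [hφ, abs_finPow, ← finPow_smul]
  exact forall_inf_nsmul_finPow_le hArch (abs_nonneg φ) (abs_nonneg g) (smul_nonneg hc.le h.1)
    hle k

theorem IsMajorant.of_pow (hArch : IsArchimedeanLattice A) (hs : IsSemiprimeAlgebra A)
    (hP : (P : Set A) = productSet A (n + 1)) (hu : 0 ≤ u)
    (h : IsMajorant (LatticeSubalgebra.pow hP g) (LatticeSubalgebra.pow hP u)) :
    IsMajorant g u := by
  refine ⟨hu, fun x => ?_⟩
  obtain ⟨c, hc, hle⟩ := (LatticeSubalgebra.isMajorant_iff.1 h).2 (finPow (n + 1) x)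
    (hP.symm.subset (finPow_mem_productSet _ x))
  let r : ℝ := c ^ ((n + 1 : ℕ) : ℝ)⁻¹
  have hr : 0 < r := Real.rpow_pos_of_pos hc _
  have hrc : r ^ (n + 1) = c := Real.rpow_inv_natCast_pow hc.le n.succ_ne_zero
  refine ⟨r, hr, hs.forall_inf_nsmul_le_of_finPow hArch (abs_nonneg x) (abs_nonneg g)
    (smul_nonneg hr.le hu) (n := n) fun k => ?_⟩
  rw [finPow_smul, hrc, ← abs_finPow, ← abs_finPow]
  exact hle k

theorem IsFiniteElement.of_pow (hArch : IsArchimedeanLattice A) (hUnif : IsUniformlyComplete A)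
    (hs : IsSemiprimeAlgebra A) (hP : (P : Set A) = productSet A (n + 2))
    (h : IsFiniteElement (LatticeSubalgebra.pow hP g)) : IsFiniteElement g := by
  obtain ⟨z, hz⟩ := h
  obtain ⟨φ, hφ⟩ := exists_abs_eq_finPow_abs hArch hUnif (hP.subset z.2)
  have hzφ : z = LatticeSubalgebra.pow hP |φ| :=
    Subtype.ext ((abs_of_nonneg (LatticeSubalgebra.isMajorant_iff.1 hz).1).symm.trans hφ)
  exact ⟨|φ|, (hzφ ▸ hz).of_pow hArch hs hP (abs_nonneg φ)⟩

end Majorants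

theorem theorem11 {A : Type*} [NonUnitalRing A] [Lattice A] [IsOrderedAddMonoid A]
    [Module ℝ A] [IsOrderedModule ℝ A] [IsScalarTower ℝ A A] [SMulCommClass ℝ A A]
    [IsFAlgebra A] (hArch : IsArchimedeanLattice A) (hUnif : IsUniformlyComplete A)
    (p : ℕ) (hp : 2 ≤ p) :
    ∃ (P : LatticeSubalgebra A) (hP : (P : Set A) = productSet A p),
      (∀ g u : A, IsMajorant g u →
        IsMajorant (LatticeSubalgebra.pow hP g) (LatticeSubalgebra.pow hP u)) ∧
      (IsSemiprimeAlgebra A →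
        (∀ g u : A, 0 ≤ u →
          (IsMajorant g u ↔
            IsMajorant (LatticeSubalgebra.pow hP g) (LatticeSubalgebra.pow hP u))) ∧
        (∀ g : A, IsFiniteElement g ↔ IsFiniteElement (LatticeSubalgebra.pow hP g))) := by
  obtain ⟨n, rfl⟩ := Nat.exists_eq_add_of_le' hp
  have hP : (productSubalgebra hArch hUnif n : Set A) = productSet A (n + 2) := rfl
  have majorant_pow (g u : A) (h : IsMajorant g u) := h.pow hArch hUnif hP
  refine ⟨productSubalgebra hArch hUnif n, hP, majorant_pow, fun hs => ⟨fun g u hu => ?_,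
    fun g => ?_⟩⟩
  · exact ⟨majorant_pow g u, fun h => h.of_pow hArch hs hP hu⟩
  · exact ⟨fun ⟨u, hu⟩ => ⟨_, majorant_pow g u hu⟩, fun h => h.of_pow hArch hUnif hs hP⟩
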